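/- Let $n,m\ge 1$ with $n+m$ even, and let $T$ be a plane bipartite tree with white vertices labelled $v_1,\dots,v_n$ and black vertices labelled $u_1,\dots,u_m$ (plane trees are considered up to orientation-preserving homeomorphism of the plane, i.e. a tree together with the counterclockwise cyclic order of the neighbours around each vertex). Choose a white root vertex $v_i$ and a root edge $e$ at $v_i$. Go once around $T$ counterclockwise, starting at $v_i$ along $e$ and keeping $e$ to the left; on meeting a vertex for the first time write its label, and on meeting it for the last time write a closing bracket (for a non-root leaf: its label, then a bracket). This gives a string $c(T)$. Let $a$ be the number of pairs $k>l$ with $v_k$ before $v_l$ in $c(T)$, $b$ the number of pairs $k>l$ with $u_k$ before $u_l$, $c$ the number of pairs consisting of a black label standing before a white label, $d$ the number of pairs consisting of a closing bracket standing before a label, and $e_0=|n-m|/2$. Put $$i(T)\in\{0,1\},\qquad i(T)\equiv a+b+c+\frac{d+e_0}{2}\pmod 2 .$$ An elementary movement of $T$ is the following: a leaf $A$ (a white or black vertex of degree one, with its edge) is disengaged from its neighbour $B$; it is then moved, clockwise or counterclockwise, around the remaining plane tree, starting from the place at $B$ where it was attached, until it has bypassed exactly one vertex of its own colour and next meets a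 vertex $C$ of the opposite colour ($C=B$ is allowed); and it is attached to $C$ at the place reached. Theorem. If $T'$ is obtained from $T$ by an elementary movement, then $i(T')=1-i(T)$, whatever root vertices and root edges are used to compute $i(T)$ and $i(T')$. That is, an elementary movement changes the parity of a tree. -/

import Mathlib

namespace PlaneTrees

/-- The vertices of a labelled `(n,m)`-tree: `n` white vertices (`Sum.inl k` carries the label
`v_k`) and `m` black vertices (`Sum.inr k` carries the label `u_k`). Labels are numbered
from `0`. -/
abbrev Vert (n m : ℕ) : Type := Fin n ⊕ Fin m

/-- `x` and `y` have the same colour. -/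
abbrev SameColour {n m : ℕ} (x y : Vert n m) : Prop := x.isLeft = y.isLeft

/-- A plane labelled bipartite `(n,m)`-tree: a tree on the labelled vertices, all of whose edges
join vertices of different colours, with its embedding in the oriented plane (up to orientation
preserving homeomorphism) given by the rotation system: `rot x` sends every neighbour `y` of `x`
to the neighbour of `x` that comes next after `y` in the counterclockwise order around `x`.
By convention `rot x` fixes all non-neighbours of `x`. -/
structure PlaneTree (n m : ℕ) where
  graph : SimpleGraph (Vert n m)
  isTree : graph.IsTree
  bipartite : ∀ x y, graph.Adj x y → ¬ SameColour x y
  rot : Vert n m → Equiv.Perm (Vert n m)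
  rot_cycle : ∀ x, (rot x).IsCycleOn (graph.neighborSet x)
  rot_fix : ∀ x y, ¬ graph.Adj x y → rot x y = y

/-- The two senses in which one can go around a plane tree. -/
inductive Sense
  | ccw
  | cw

/-- A corner `(x, y)` is the angular sector at the vertex `x` between the edge `xy` and the
edge that follows `xy` in the counterclockwise order around `x`. `nextCorner s ρ c` is the corner
that follows `c` when one goes around a tree with rotation system `ρ` in the sense `s`.
Counterclockwise: from the corner `(x, y)` one runs along the edge from `x` to `z = ρ x y`,
keeping this edge to the left, and arrives in the corner `(z, x)`. Clockwise is the inverse. -/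
def nextCorner {n m : ℕ} (s : Sense) (ρ : Vert n m → Equiv.Perm (Vert n m))
    (c : Vert n m × Vert n m) : Vert n m × Vert n m :=
  match s with
  | .ccw => (ρ c.1 c.2, c.1)
  | .cw => (c.2, (ρ c.2).symm c.1)

/-- The corner reached from `c` after `t` steps. -/
def cornerAt {n m : ℕ} (s : Sense) (ρ : Vert n m → Equiv.Perm (Vert n m))
    (c : Vert n m × Vert n m) (t : ℕ) : Vert n m × Vert n m :=
  (nextCorner s ρ)^[t] c

/-! ### The string of labels and closing brackets -/

/-- The symbols of the string `c(T)`: white labels, black labels, closing brackets. -/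
inductive Symb (n m : ℕ)
  | white (k : Fin n)
  | black (k : Fin m)
  | close

/-- The label of a vertex. -/
def label {n m : ℕ} : Vert n m → Symb n m
  | .inl k => .white k
  | .inr k => .black k

/-- The vertices met, in order and with repetitions, on the full counterclockwise tour of the tree
that starts at the vertex `r` along the edge `rw`. Each of the `n + m - 1` edges is traversed
twice, so the tour meets `2 (n + m) - 1` vertices, the first and the last of them being `r`. -/
def tour {n m : ℕ} (ρ : Vert n m → Equiv.Perm (Vert n m)) (r w : Vert n m) : List (Vert n m) :=
  (List.range (2 * (n + m) - 1)).map fun t => (cornerAt .ccw ρ (r, (ρ r).symm w) t).1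

/-- Read a list of visits from left to right, `seen` being the vertices already met: at the first
visit of a vertex `x` write its label `lab x`, at the last visit write a closing bracket `close`. -/
def writeString {α σ : Type*} [DecidableEq α] (lab : α → σ) (close : σ) (seen : List α) :
    List α → List σ
  | [] => []
  | x :: rest =>
    (if x ∈ seen then [] else [lab x]) ++ (if x ∈ rest then [] else [close]) ++
      writeString lab close (x :: seen) rest

/-- The string `c(T)` for the root vertex `r` and the root edge `rw`. -/
def PlaneTree.string {n m : ℕ} (T : PlaneTree n m) (r w : Vert n m) : List (Symb n m) :=
  writeString label .close [] (tour T.rot r w)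

/-! ### The invariant -/

/-- The number of pairs of positions `p < q` of the list with `P (l[p]) (l[q])`. -/
def pairCount {α : Type*} (P : α → α → Bool) : List α → ℕ
  | [] => 0
  | x :: l => l.countP (P x) + pairCount P l

/-- Inversion in white labels. -/
def whiteInv {n m : ℕ} : Symb n m → Symb n m → Bool
  | .white k, .white l => decide (l < k)
  | _, _ => false

/-- Inversion in black labels. -/
def blackInv {n m : ℕ} : Symb n m → Symb n m → Bool
  | .black k, .black l => decide (l < k)
  | _, _ => false

/-- A black label before a white label. -/
def blackWhite {n m : ℕ} : Symb n m → Symb n m → Bool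
  | .black _, .white _ => true
  | _, _ => false

/-- A closing bracket before a label. -/
def closeLabel {n m : ℕ} : Symb n m → Symb n m → Bool
  | .close, .white _ => true
  | .close, .black _ => true
  | _, _ => false

/-- `a + b + c + (d + e) / 2` reduced modulo 2, for a string of an `(n,m)`-tree, where
`e = |n - m| / 2`. For trees with an even number of vertices both divisions are exact. -/
def stringInvariant {n m : ℕ} (s : List (Symb n m)) : ℕ :=
  (pairCount whiteInv s + pairCount blackInv s + pairCount blackWhite s +
    (pairCount closeLabel s + ((n : ℤ) - (m : ℤ)).natAbs / 2) / 2) % 2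

/-- The invariant `i(T) ∈ {0, 1}`, computed with the white root vertex `v_i` and the root edge
from `v_i` to the black vertex `u_j`. -/
def PlaneTree.invariant {n m : ℕ} (T : PlaneTree n m) (i : Fin n) (j : Fin m) : ℕ :=
  stringInvariant (T.string (.inl i) (.inr j))

/-! ### Movements of leaves -/

/-- The rotation system after the leaf `A` has been disengaged: `A` is cut out of the cyclic order
around every vertex. -/
def detach {n m : ℕ} (ρ : Vert n m → Equiv.Perm (Vert n m)) (A : Vert n m) :
    Vert n m → Equiv.Perm (Vert n m) :=
  fun x => Equiv.swap A (ρ x A) * ρ x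

/-- The rotation system after the disengaged vertex `A` has been attached to `c.1` inside the
corner `c`: around `c.1`, the new neighbour `A` comes immediately after `c.2`. -/
def attach {n m : ℕ} (ρ : Vert n m → Equiv.Perm (Vert n m)) (A : Vert n m)
    (c : Vert n m × Vert n m) : Vert n m → Equiv.Perm (Vert n m) :=
  Function.update ρ c.1 (Equiv.swap A (ρ c.1 c.2) * ρ c.1)

/-- The corner of the tree without the leaf `A` that is met at time `t`, when `A`, attached to `B`
in `T`, is disengaged and moved around the rest of the tree in the sense `s`. At time `0` it is
the corner at `B` in which the leaf was attached. -/
def PlaneTree.leafCorner {n m : ℕ} (T : PlaneTree n m) (A B : Vert n m) (s : Sense) (t : ℕ) :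
    Vert n m × Vert n m :=
  cornerAt s (detach T.rot A) (B, (T.rot B).symm A) t

/-- `T'` is obtained from `T` by the movement that disengages the leaf `A` from its neighbour `B`,
moves it in the sense `s` around the rest of the tree through `L` corners and attaches it to the
vertex reached, which has the colour opposite to the colour of `A`. -/
structure IsMovement {n m : ℕ} (T T' : PlaneTree n m) (A B : Vert n m) (s : Sense) (L : ℕ) :
    Prop where
  adj : T.graph.Adj A B
  leaf : ∀ x, T.graph.Adj A x → x = B
  /-- The rest of the tree is not the single vertex `B`, so that one can move along it. -/
  rest : ∃ D, D ≠ A ∧ T.graph.Adj B D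
  colour : ¬ SameColour (T.leafCorner A B s L).1 A
  graph_eq : T'.graph =
    T.graph.deleteIncidenceSet A ⊔ SimpleGraph.edge A (T.leafCorner A B s L).1
  rot_eq : T'.rot = attach (detach T.rot A) A (T.leafCorner A B s L)

/-- The number of vertices of the colour of the leaf `A` bypassed in a movement through `L`
corners, counted with multiplicity. -/
def PlaneTree.bypassed {n m : ℕ} (T : PlaneTree n m) (A B : Vert n m) (s : Sense) (L : ℕ) : ℕ :=
  ((Finset.range L).filter fun t => SameColour (T.leafCorner A B s t).1 A).card

/-- `T'` is obtained from `T` by an elementary movement: a movement of a (white or black) leaf,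
clockwise or counterclockwise, that bypasses exactly one vertex of the colour of the leaf. -/
def IsElementaryMovement {n m : ℕ} (T T' : PlaneTree n m) : Prop :=
  ∃ (A B : Vert n m) (s : Sense) (L : ℕ), IsMovement T T' A B s L ∧ T.bypassed A B s L = 1

end PlaneTrees

namespace PlaneTrees

/-! The whole argument concerns `2 * inversions + closings` modulo 4, computed on the word of
vertices met on a tour. Here `a + b + c` is the number of inversions of the order of first visits,
for the order that puts white labels before black ones, and `d` is `closings`. Moving the root to
the next corner lowers this statistic by `n + m` modulo 4 (`reroot_word`, `statistic_nextPerm`): the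
old root passes the `p` vertices beyond the root edge, which changes twice the inversions by `2p`,
and the brackets change by `p - q`, where `p + q = n + m`. Since `n + m` is even, two steps change
nothing, so the statistic depends only on the colour of the root (`statistic_modEq`). Colours
alternate along the tour, so an elementary movement passes exactly two corners
(`IsMovement.eq_two`). Rooted at the corner where the leaf `a` sits, the tour changes from `b a b y
z w` to `b y z a z w`. If `y` is a leaf of the remaining tree, then `z = b`, one inversion changes
and `closings` does not; otherwise `a` passes two new letters, the inversions keep their parity and
`closings` drops by 2. Both cases change the statistic by 2 modulo 4 (`move_word`,
`statistic_attach`). -/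

/-- Moving a letter to the right over `l.length` other letters. -/
theorem pairCount_move {α : Type*} {Q : α → α → Bool} (hQ : ∀ x y, x ≠ y → Q x y = !Q y x) {r : α}
    {l : List α} (hr : r ∉ l) (l' : List α) :
    ∃ t, pairCount Q (r :: l ++ l') + pairCount Q (l ++ r :: l') = l.length + 2 * t := by
  induction l with
  | nil => exact ⟨pairCount Q (r :: l'), by simp; ring⟩
  | cons x l ih =>
    obtain ⟨t, ht⟩ := ih fun h => hr (by simp [h])
    have hx := hQ r x (by rintro rfl; simp at hr)
    refine ⟨t + l.countP (Q x) + l'.countP (Q x), ?_⟩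
    simp only [List.cons_append, pairCount, List.countP_cons, List.countP_append, hx,
      List.length_cons] at ht ⊢
    cases Q x r <;> simp <;> omega

/-! ### Combinatorics of words: first and last occurrences. -/

section Words

variable {α : Type*} [DecidableEq α]

/-- The letters of a word outside `seen`, in the order of their first occurrences. -/
def firsts : List α → List α → List α
  | _, [] => []
  | seen, x :: w => (if x ∈ seen then [] else [x]) ++ firsts (x :: seen) w

/-- The number of pairs of a letter of the word and a letter outside `seen` that occurs for the
first time after the last occurrence of the former. -/
def closings : List α → List α → ℕ
  | _, [] => 0
  | seen, x :: w => (if x ∈ w then 0 else (firsts (x :: seen) w).length) + closings (x :: seen) w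

theorem firsts_congr {s s' : List α} (w : List α) (h : ∀ x ∈ w, x ∈ s ↔ x ∈ s') :
    firsts s w = firsts s' w := by
  induction w generalizing s s' with
  | nil => rfl
  | cons x w ih =>
    simp only [firsts, h x (by simp)]
    rw [ih (s := x :: s) (s' := x :: s')]
    intro y hy
    simp [h y (by simp [hy])]

theorem closings_congr {s s' : List α} (w : List α) (h : ∀ x ∈ w, x ∈ s ↔ x ∈ s') :
    closings s w = closings s' w := by
  induction w generalizing s s' with
  | nil => rfl
  | cons x w ih =>
    have h' : ∀ y ∈ w, y ∈ x :: s ↔ y ∈ x :: s' := fun y hy => by simp [h y (by simp [hy])]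
    simp only [closings, ih h', firsts_congr w h']

theorem mem_firsts {s w : List α} {x : α} : x ∈ firsts s w ↔ x ∈ w ∧ x ∉ s := by
  induction w generalizing s with
  | nil => simp [firsts]
  | cons y w ih =>
    simp only [firsts, List.mem_append, ih, List.mem_cons]
    by_cases hy : y ∈ s <;> by_cases hx : x = y <;> simp_all

theorem nodup_firsts (s w : List α) : (firsts s w).Nodup := by
  induction w generalizing s with
  | nil => simp [firsts]
  | cons y w ih =>
    simp only [firsts]
    split_ifs with h
    · simpa using ih _
    · simp [ih, mem_firsts]

theorem firsts_append (s v w : List α) :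
    firsts s (v ++ w) = firsts s v ++ firsts (v ++ s) w := by
  induction v generalizing s with
  | nil => simp [firsts]
  | cons x v ih =>
    simp only [List.cons_append, firsts, ih, List.append_assoc]
    congr 2
    exact firsts_congr _ fun y _ => by simp; tauto

/-- Disjointness makes every letter of `v` close before `w` starts, so each distinct letter of `v`
precedes every new letter of `w`; this gives the product term. -/
theorem closings_append {v w : List α} (s : List α) (h : ∀ x ∈ v, x ∉ w) :
    closings s (v ++ w) = closings s v + (v.toFinset.card) * (firsts (v ++ s) w).length +
      closings (v ++ s) w := by
  induction v generalizing s with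
  | nil => simp [closings]
  | cons x v ih =>
    have hx : x ∉ w := h x (by simp)
    have hs : ∀ y ∈ w, y ∈ v ++ x :: s ↔ y ∈ x :: v ++ s := fun y _ => by simp; tauto
    simp only [List.cons_append, closings, ih (x :: s) fun y hy => h y (by simp [hy]),
      firsts_append, List.mem_append, hx, or_false, List.length_append, List.toFinset_cons]
    rw [firsts_congr w hs, closings_congr w hs, List.cons_append]
    by_cases hv : x ∈ v
    · simp [hv]
    · simp [hv]
      ring

theorem firsts_append_singleton {s w : List α} {u : α} (h : u ∈ w ∨ u ∈ s) :
    firsts s (w ++ [u]) = firsts s w := by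
  simp [firsts_append, firsts, h]

theorem closings_append_singleton_of_notMem {s w : List α} {u : α} (h : u ∈ s) (hw : u ∉ w) :
    closings s (w ++ [u]) = closings s w := by
  induction w generalizing s with
  | nil => simp [closings, firsts]
  | cons x w ih =>
    have hx : x ≠ u := by rintro rfl; simp at hw
    have hs : u ∈ x :: s := by simp [h]
    simp only [List.cons_append, closings, ih hs (fun h' => hw (by simp [h'])), List.mem_append,
      firsts_append_singleton (Or.inr hs), List.mem_singleton, hx, or_false]

/-- The extra `u` postpones the closing of `u` to the very end, which loses exactly its pairs with
the letters first met in `w`. -/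
theorem closings_append_singleton {s v w : List α} {u : α} (hw : u ∉ w) :
    closings s (v ++ u :: w ++ [u]) + (firsts (v ++ u :: s) w).length =
      closings s (v ++ u :: w) := by
  induction v generalizing s with
  | nil =>
    simp only [List.nil_append, List.cons_append, closings, hw, List.mem_append,
      closings_append_singleton_of_notMem (List.mem_cons_self (a := u) (l := s)) hw]
    simp [add_comm]
  | cons x v ih =>
    have hm : x ∈ v ++ u :: w ++ [u] ↔ x ∈ v ++ u :: w := by simp; tauto
    have hf : firsts (x :: s) (v ++ u :: w ++ [u]) = firsts (x :: s) (v ++ u :: w) :=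
      firsts_append_singleton (by simp)
    have hc : firsts (x :: v ++ u :: s) w = firsts (v ++ u :: x :: s) w :=
      firsts_congr w fun y _ => by simp; tauto
    have := ih (s := x :: s)
    simp only [List.cons_append] at hc hf hm this ⊢
    rw [hc, closings, closings, hf, ← this, add_assoc]
    simp only [hm]

theorem length_firsts (w : List α) : (firsts [] w).length = w.toFinset.card := by
  rw [← List.toFinset_card_of_nodup (nodup_firsts [] w)]
  congr 1
  ext x
  simp [mem_firsts]

/-- The number of inversions of the order of first occurrences in a word. -/
def inversions (Q : α → α → Bool) (w : List α) : ℕ := pairCount Q (firsts [] w)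

/-- The effect on the two statistics of moving the root of the tour of a tree to the next vertex
of the tour. -/
theorem reroot_word {Q : α → α → Bool} (hQ : ∀ x y, x ≠ y → Q x y = !Q y x) {r u : α}
    {v w : List α} (h : ∀ x ∈ v ++ [u], x ∉ r :: w) :
    2 * inversions Q (v ++ u :: r :: w ++ [u]) + closings [] (v ++ u :: r :: w ++ [u]) +
        (v ++ u :: r :: w).toFinset.card ≡
      2 * inversions Q (r :: (v ++ u :: r :: w)) + closings [] (r :: (v ++ u :: r :: w))
        [MOD 4] := by
  set V := v ++ [u] with hV
  have hrV : r ∉ V := fun hr => h r hr (by simp)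
  have e : v ++ u :: r :: w = V ++ r :: w := by simp [hV]
  have hc := closings_append_singleton (s := []) (v := v) (w := r :: w) (u := u)
    (h u (by simp [hV]))
  have h1 : firsts [] V = firsts [r] V := firsts_congr _ fun x hx => by
    simp; rintro rfl; exact hrV hx
  have hf : firsts (v ++ [u]) (r :: w) = r :: firsts (r :: V) w := by
    rw [← hV, firsts, if_neg hrV]; rfl
  have hfr : firsts (V ++ [r]) (r :: w) = firsts (r :: V) w := by
    rw [firsts, if_pos (by simp)]
    exact firsts_congr _ fun x _ => by simp; tauto
  have hI : inversions Q (v ++ u :: r :: w ++ [u]) =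
      pairCount Q (firsts [] V ++ r :: firsts (r :: V) w) := by
    rw [inversions, firsts_append_singleton (by simp), e, firsts_append, List.append_nil, hV, hf]
  have hI' : inversions Q (r :: (v ++ u :: r :: w)) =
      pairCount Q (r :: firsts [] V ++ firsts (r :: V) w) := by
    rw [inversions, e, firsts, firsts_append, hfr, h1]; rfl
  have hN : (v ++ u :: r :: w).toFinset.card = V.toFinset.card + 1 + (firsts (r :: V) w).length := by
    rw [← length_firsts, e, firsts_append, List.append_nil, hV, hf, List.length_append,
      length_firsts, List.length_cons]
    ring
  -- In the order of first occurrences, rerooting only carries `r` from the front to just behind the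
  -- letters of `V`.
  obtain ⟨t, ht⟩ := pairCount_move hQ (r := r) (l := firsts [] V)
    (by simp [mem_firsts, hrV]) (firsts (r :: V) w)
  have hd : closings [] (v ++ u :: r :: w) = closings [] V +
      V.toFinset.card * ((firsts (r :: V) w).length + 1) + closings V (r :: w) := by
    rw [e, closings_append [] h, List.append_nil, hV, hf, List.length_cons]
  have hd' : closings [] (r :: (v ++ u :: r :: w)) = closings [] V +
      V.toFinset.card * (firsts (r :: V) w).length + closings V (r :: w) := by
    rw [closings, if_pos (by simp), e, closings_append [r] h, hfr, zero_add]
    congr 1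
    · congr 1
      exact closings_congr _ fun x hx => by simp; rintro rfl; exact hrV hx
    · simp only [closings]
      rw [firsts_congr (s := r :: (V ++ [r])) (s' := r :: V) w fun x _ => by simp; tauto,
        closings_congr (s := r :: (V ++ [r])) (s' := r :: V) w fun x _ => by simp; tauto]
  -- With `p` distinct letters in `V` and `q` others (including `r`), `closings` changes by `p - q`;
  -- together with the change `2p` of twice the inversions and the added `p + q` this is `4p`.
  rw [hf, List.length_cons] at hc
  rw [length_firsts] at ht
  rw [hI, hI', hN, hd']
  rw [hd] at hc
  rw [mul_add, mul_one] at hc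
  rw [Nat.ModEq]
  omega

end Words


/-- The effect on the two statistics of an elementary movement. -/
theorem move_word {α : Type*} [DecidableEq α] {Q : α → α → Bool}
    (hQ : ∀ x y, x ≠ y → Q x y = !Q y x) {a b y z : α}
    {w : List α} (haw : a ∉ w) (hab : a ≠ b) (hay : a ≠ y) (haz : a ≠ z) (hby : b ≠ y)
    (hyz : y ≠ z) (hb : b ∈ w) (h : z = b ↔ y ∉ w) :
    2 * inversions Q (b :: a :: b :: y :: z :: w) + closings [] (b :: a :: b :: y :: z :: w) + 2 ≡
      2 * inversions Q (b :: y :: z :: a :: z :: w) + closings [] (b :: y :: z :: a :: z :: w)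
        [MOD 4] := by
  -- For `z = b` the letter `y` closes at once, and the bracket pairs of `a` and `y` merely trade
  -- places. Otherwise `y` stays open, and the bracket of `a` no longer precedes the labels `y` and
  -- `z`.
  by_cases hz : z = b
  · subst hz
    have hyw := h.1 rfl
    have e1 : firsts [z, y, z, a, z] w = firsts [z, a, z, y, z] w :=
      firsts_congr _ fun x _ => by simp; tauto
    have e2 : closings [z, y, z, a, z] w = closings [z, a, z, y, z] w :=
      closings_congr _ fun x _ => by simp; tauto
    obtain ⟨t, ht⟩ := pairCount_move hQ (r := a) (l := [y]) (by simpa using hay)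
      (firsts [z, a, z, y, z] w)
    simp [inversions, closings, firsts, pairCount, hab, hab.symm, hay, hay.symm, hby.symm, hby,
      haw, hyw, hb, e1, e2, List.countP_cons] at ht ⊢
    rw [Nat.ModEq]
    omega
  · have hyw : y ∈ w := by tauto
    have e1 : firsts [z, y, b, a, b] w = firsts [z, a, z, y, b] w :=
      firsts_congr _ fun x _ => by simp; tauto
    have e2 : closings [z, y, b, a, b] w = closings [z, a, z, y, b] w :=
      closings_congr _ fun x _ => by simp; tauto
    obtain ⟨t, ht⟩ := pairCount_move hQ (r := a) (l := [y, z]) (by simp [hay, haz])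
      (firsts [z, a, z, y, b] w)
    simp [inversions, closings, firsts, pairCount, hab, hab.symm, hay, hay.symm, hby.symm, hby,
      haw, hyw, hb, e1, e2, List.countP_cons, hz, Ne.symm hz, haz, haz.symm, hyz, hyz.symm] at ht ⊢
    rw [Nat.ModEq]
    omega

/-! ### From strings with brackets to words of vertices. -/

section Strings

variable {n m : ℕ}

theorem countP_writeString {P : Symb n m → Bool} (hP : P .close = false)
    (s w : List (Vert n m)) :
    (writeString label .close s w).countP P = (firsts s w).countP fun x => P (label x) := by
  induction w generalizing s with
  | nil => rfl
  | cons x w ih =>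
    simp only [writeString, firsts, List.countP_append, ih]
    split_ifs <;> simp [hP]

theorem pairCount_writeString {P : Symb n m → Symb n m → Bool} (hP : ∀ x, P .close x = false)
    (hP' : ∀ x, P x .close = false) (s w : List (Vert n m)) :
    pairCount P (writeString label .close s w) =
      pairCount (fun x y => P (label x) (label y)) (firsts s w) := by
  induction w generalizing s with
  | nil => rfl
  | cons x w ih =>
    simp only [writeString, firsts]
    split_ifs <;> simp [pairCount, hP, ih, countP_writeString, hP']

theorem pairCount_closeLabel_writeString (s w : List (Vert n m)) :
    pairCount closeLabel (writeString label .close s w) = closings s w := by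
  have h1 (s w : List (Vert n m)) :
      (writeString label .close s w).countP (closeLabel .close) = (firsts s w).length := by
    rw [countP_writeString rfl, List.countP_eq_length]
    rintro (x | x) _ <;> rfl
  have h2 (x : Vert n m) (l : List (Symb n m)) : l.countP (closeLabel (label x)) = 0 := by
    rw [List.countP_eq_zero]
    rcases x with x | x <;> simp [label, closeLabel]
  induction w generalizing s with
  | nil => rfl
  | cons x w ih =>
    simp only [writeString, closings]
    split_ifs <;> simp [pairCount, h1, h2, ih]

/-- Labels in the wrong order, the correct order being: first the white labels, then the black
labels, each in increasing order. -/
def wrongOrder : Vert n m → Vert n m → Bool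
  | .inl k, .inl l => decide (l < k)
  | .inr k, .inr l => decide (l < k)
  | .inr _, .inl _ => true
  | .inl _, .inr _ => false

theorem wrongOrder_swap (x y : Vert n m) (h : x ≠ y) : wrongOrder x y = !wrongOrder y x := by
  rcases x with x | x <;> rcases y with y | y <;> simp [wrongOrder]
  all_goals
    have : x ≠ y := by rintro rfl; exact h rfl
    rw [← decide_not, decide_eq_decide]
    omega

/-- The three counts are the three kinds of inversion of a single linear order on all labels, so
their sum obeys the transposition rule of `pairCount_move`. -/
theorem pairCount_wrongOrder (l : List (Vert n m)) :
    pairCount (fun x y => whiteInv (label x) (label y)) l +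
        pairCount (fun x y => blackInv (label x) (label y)) l +
        pairCount (fun x y => blackWhite (label x) (label y)) l = pairCount wrongOrder l := by
  have h (x : Vert n m) (l : List (Vert n m)) :
      l.countP (fun y => whiteInv (label x) (label y)) +
        l.countP (fun y => blackInv (label x) (label y)) +
        l.countP (fun y => blackWhite (label x) (label y)) = l.countP (wrongOrder x) := by
    induction l with
    | nil => rfl
    | cons y l ih =>
      simp only [List.countP_cons, ← ih]
      rcases x with x | x <;> rcases y with y | y <;>
        simp [wrongOrder, whiteInv, blackInv, blackWhite, label] <;> omega
  induction l with
  | nil => rfl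
  | cons x l ih =>
    simp only [pairCount, ← ih, ← h]
    omega

theorem stringInvariant_writeString (w : List (Vert n m)) :
    stringInvariant (writeString label .close [] w) =
      (inversions wrongOrder w + (closings [] w + ((n : ℤ) - (m : ℤ)).natAbs / 2) / 2) % 2 := by
  rw [stringInvariant, pairCount_closeLabel_writeString, inversions, ← pairCount_wrongOrder,
    pairCount_writeString, pairCount_writeString, pairCount_writeString]
  all_goals rintro (x | x | x) <;> rfl

end Strings


/-! ### The tour of a plane tree is a single cycle through all corners. -/

section Corners

variable {n m : ℕ}

/-- The permutation of the corners that sends a corner to the next one in the counterclockwise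
order. -/
def nextPerm (ρ : Vert n m → Equiv.Perm (Vert n m)) : Equiv.Perm (Vert n m × Vert n m) where
  toFun := nextCorner .ccw ρ
  invFun := nextCorner .cw ρ
  left_inv c := by simp [nextCorner]
  right_inv c := by simp [nextCorner]

theorem nextPerm_apply (ρ : Vert n m → Equiv.Perm (Vert n m)) (c : Vert n m × Vert n m) :
    nextPerm ρ c = (ρ c.1 c.2, c.1) := rfl

theorem cornerAt_ccw (ρ : Vert n m → Equiv.Perm (Vert n m)) (c : Vert n m × Vert n m) (t : ℕ) :
    cornerAt .ccw ρ c t = (nextPerm ρ ^ t) c := by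
  rw [← Equiv.Perm.iterate_eq_pow]
  rfl

namespace PlaneTree

variable (T : PlaneTree n m)

open Classical in
/-- The corners of a plane tree. -/
noncomputable def corners : Finset (Vert n m × Vert n m) :=
  Finset.univ.filter fun c => T.graph.Adj c.1 c.2

variable {T}

theorem mem_corners {c : Vert n m × Vert n m} : c ∈ T.corners ↔ T.graph.Adj c.1 c.2 := by
  simp [corners]

theorem adj_rot_iff {x y : Vert n m} : T.graph.Adj x (T.rot x y) ↔ T.graph.Adj x y :=
  (T.rot_cycle x).apply_mem_iff

theorem nextPerm_mem_corners {c : Vert n m × Vert n m} :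
    nextPerm T.rot c ∈ T.corners ↔ c ∈ T.corners := by
  rw [mem_corners, mem_corners, nextPerm_apply, SimpleGraph.adj_comm, adj_rot_iff]

theorem pow_nextPerm_mem_corners {c : Vert n m × Vert n m} (h : c ∈ T.corners) (k : ℕ) :
    (nextPerm T.rot ^ k) c ∈ T.corners := by
  induction k with
  | zero => exact h
  | succ k ih => rw [pow_succ', Equiv.Perm.mul_apply, nextPerm_mem_corners]; exact ih

theorem card_corners : T.corners.card = 2 * (n + m - 1) := by
  classical
  have h1 : T.corners.card = Fintype.card T.graph.Dart := by
    rw [← Finset.card_univ]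
    refine Finset.card_bij' (fun c hc => ⟨c, mem_corners.1 hc⟩) (fun d _ => d.toProd)
      (fun _ _ => Finset.mem_univ _) (fun d _ => mem_corners.2 d.adj) (fun _ _ => rfl)
      (fun _ _ => rfl)
  have h2 := T.isTree.card_edgeFinset
  simp only [Fintype.card_sum, Fintype.card_fin] at h2
  rw [h1, T.graph.dart_card_eq_twice_card_edges]
  omega

/-- Every edge of a tree cuts the set of vertices into two parts joined by this edge only. -/
theorem exists_cut {u v : Vert n m} (h : T.graph.Adj u v) :
    ∃ S : Vert n m → Prop, S u ∧ ¬ S v ∧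
      ∀ x y, T.graph.Adj x y → (x, y) ≠ (u, v) → (x, y) ≠ (v, u) → (S x ↔ S y) := by
  have hb := SimpleGraph.isBridge_iff.1
    (SimpleGraph.isAcyclic_iff_forall_adj_isBridge.1 T.isTree.isAcyclic h)
  refine ⟨fun x => (T.graph.deleteEdges {s(u, v)}).Reachable u x, .rfl, hb, fun x y hxy h1 h2 => ?_⟩
  have ha : (T.graph.deleteEdges {s(u, v)}).Adj x y := by
    rw [SimpleGraph.deleteEdges_adj]
    refine ⟨hxy, ?_⟩
    simp only [Set.mem_singleton_iff, Sym2.eq_iff]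
    rintro (⟨rfl, rfl⟩ | ⟨rfl, rfl⟩)
    · exact h1 rfl
    · exact h2 rfl
  exact ⟨fun hx => hx.trans ha.reachable, fun hy => hy.trans ha.symm.reachable⟩

/-- A closed walk crosses a bridge equally often in both directions. The count uses the indicator of
one side of the cut: over the orbit, first and second components have equal sums, because each
corner's second component is the first component of its predecessor. -/
theorem sameCycle_swap {c d : Vert n m × Vert n m} (hc : c ∈ T.corners)
    (hd : (nextPerm T.rot).SameCycle c d) : (nextPerm T.rot).SameCycle c d.swap := by
  classical
  set φ := nextPerm T.rot with hφ
  set O := Finset.univ.filter fun e => φ.SameCycle c e with hO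
  have hmem (e) : e ∈ O ↔ φ.SameCycle c e := by simp [hO]
  have hOc : ∀ e ∈ O, T.graph.Adj e.1 e.2 := fun e he => by
    obtain ⟨k, -, rfl⟩ := ((hmem e).1 he).exists_pow_eq'
    exact mem_corners.1 (pow_nextPerm_mem_corners hc k)
  obtain ⟨u, v⟩ := d
  have huv : T.graph.Adj u v := hOc _ ((hmem _).2 hd)
  obtain ⟨S, hu, hv, hS⟩ := exists_cut huv
  by_contra hsw
  let f : Vert n m → ℤ := fun x => if S x then 1 else 0
  have hsum : ∑ e ∈ O, f e.1 = ∑ e ∈ O, f e.2 := by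
    refine Finset.sum_bij (fun e _ => φ e) (fun e he => ?_) (fun _ _ _ _ h => φ.injective h)
      (fun e he => ⟨φ.symm e, ?_, by simp⟩) (fun _ _ => rfl)
    · rw [hmem] at he ⊢
      exact Equiv.Perm.sameCycle_apply_right.2 he
    · rw [hmem] at he ⊢
      exact Equiv.Perm.sameCycle_symm_apply_right.2 he
  have hlt : ∑ e ∈ O, f e.2 < ∑ e ∈ O, f e.1 := by
    refine Finset.sum_lt_sum (fun e he => ?_) ⟨(u, v), (hmem _).2 hd, by simp [f, hu, hv]⟩
    by_cases h1 : e = (u, v)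
    · simp [f, h1, hu, hv]
    · have h2 : e ≠ (v, u) := by
        rintro rfl
        exact hsw ((hmem _).1 he)
      simp [f, hS _ _ (hOc e he) h1 h2]
  omega

/-- Going around a plane tree one meets all its corners. -/
theorem isCycleOn_corners : (nextPerm T.rot).IsCycleOn T.corners := by
  classical
  refine ⟨⟨fun c hc => by simpa [nextPerm_mem_corners] using hc, (Equiv.injective _).injOn,
    fun c hc => ⟨(nextPerm T.rot).symm c, ?_, by simp⟩⟩, ?_⟩
  · rw [Finset.mem_coe, ← nextPerm_mem_corners]
    simpa using hc
  intro c hc d hd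
  rw [Finset.mem_coe] at hc hd
  -- Passing from `(x, y)` to the next corner and then reversing it rotates `y` by one place around
  -- `x`.
  have step (x y z : Vert n m) (hxy : T.graph.Adj x y) (hxz : T.graph.Adj x z)
      (h : (nextPerm T.rot).SameCycle c (x, y)) : (nextPerm T.rot).SameCycle c (x, z) := by
    obtain ⟨k, rfl⟩ := (T.rot_cycle x).exists_pow_eq' (Set.toFinite _) hxy hxz
    clear hxz
    induction k with
    | zero => exact h
    | succ k ih =>
      rw [pow_succ', Equiv.Perm.mul_apply]
      exact sameCycle_swap hc (Equiv.Perm.sameCycle_apply_right.2 ih)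
  have key (x : Vert n m) (hx : T.graph.Reachable c.1 x) :
      ∀ y, T.graph.Adj x y → (nextPerm T.rot).SameCycle c (x, y) := by
    obtain ⟨p⟩ := hx
    have hc' : ∀ y, T.graph.Adj c.1 y → (nextPerm T.rot).SameCycle c (c.1, y) := fun y hy =>
      step _ _ _ (mem_corners.1 hc) hy .rfl
    generalize c.1 = a at p hc'
    induction p with
    | nil => exact hc'
    | cons hadj p ih =>
      exact ih fun y hy => step _ _ _ hadj.symm hy (sameCycle_swap hc (hc' _ hadj))
  exact key d.1 (T.isTree.connected _ _) d.2 (mem_corners.1 hd)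

theorem pow_nextPerm_eq_iff {c : Vert n m × Vert n m} (hc : c ∈ T.corners) (k : ℕ) :
    (nextPerm T.rot ^ k) c = c ↔ 2 * (n + m - 1) ∣ k := by
  rw [isCycleOn_corners.pow_apply_eq hc, card_corners]

theorem exists_pow_nextPerm_eq {c d : Vert n m × Vert n m} (hc : c ∈ T.corners)
    (hd : d ∈ T.corners) : ∃ k < 2 * (n + m - 1), (nextPerm T.rot ^ k) c = d := by
  rw [← card_corners (T := T)]
  exact isCycleOn_corners.exists_pow_eq hc hd

end PlaneTree

end Corners


/-! ### Dependence of the statistic on the root. -/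

section Statistic

variable {n m : ℕ}

/-- The vertices met on the full counterclockwise tour that starts in the corner `c`. -/
def tourFrom (ρ : Vert n m → Equiv.Perm (Vert n m)) (c : Vert n m × Vert n m) :
    List (Vert n m) :=
  (List.range (2 * (n + m) - 1)).map fun t => ((nextPerm ρ ^ t) c).1

theorem tour_eq_tourFrom (ρ : Vert n m → Equiv.Perm (Vert n m)) (r w : Vert n m) :
    tour ρ r w = tourFrom ρ (r, (ρ r).symm w) := by
  simp [tour, tourFrom, cornerAt_ccw]

/-- The statistic of a word whose behaviour modulo `4` determines the invariant. -/
def statistic (w : List (Vert n m)) : ℕ := 2 * inversions wrongOrder w + closings [] w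

theorem map_range_split {α : Type*} (f : ℕ → α) (k l : ℕ) :
    (List.range (k + 3 + l)).map f =
      f 0 :: ((List.range k).map (fun t => f (t + 1)) ++ f (k + 1) :: f (k + 2) ::
        (List.range l).map fun t => f (t + (k + 3))) := by
  rw [List.range_add, List.range_succ, List.range_succ, List.range_succ_eq_map]
  simp [Function.comp_def, add_comm, add_left_comm]

theorem map_range_succ_split {α : Type*} (f : ℕ → α) (k l : ℕ) :
    (List.range (k + 3 + l)).map (fun t => f (t + 1)) =
      (List.range k).map (fun t => f (t + 1)) ++ f (k + 1) :: f (k + 2) ::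
        (List.range l).map (fun t => f (t + (k + 3))) ++ [f (l + (k + 3))] := by
  have := map_range_split f k (l + 1)
  rw [← add_assoc, List.range_succ_eq_map, List.map_cons, List.range_succ (n := l)] at this
  simpa [Function.comp_def] using (List.cons.inj this).2

namespace PlaneTree

variable {T : PlaneTree n m}

theorem toFinset_eq_univ {c : Vert n m × Vert n m} (hc : c ∈ T.corners) {w : List (Vert n m)}
    (h : ∀ k < 2 * (n + m - 1), ((nextPerm T.rot ^ (k + 1)) c).1 ∈ w) :
    w.toFinset = Finset.univ := by
  ext x
  simp only [List.mem_toFinset, Finset.mem_univ, iff_true]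
  obtain ⟨y, hy⟩ : ∃ y, T.graph.Adj x y := by
    rcases eq_or_ne x c.1 with rfl | hx
    · exact ⟨_, mem_corners.1 hc⟩
    · have : Nontrivial (Vert n m) := ⟨x, c.1, hx⟩
      exact T.isTree.connected.preconnected.exists_adj_of_nontrivial x
  obtain ⟨k, hk, h'⟩ := exists_pow_nextPerm_eq (nextPerm_mem_corners.2 hc)
    (mem_corners.2 hy : (x, y) ∈ T.corners)
  have := h k hk
  rw [pow_succ, Equiv.Perm.mul_apply, h'] at this
  exact this

/-- The effect of moving the root to the next corner. -/
theorem statistic_nextPerm {c : Vert n m × Vert n m} (hc : c ∈ T.corners) :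
    statistic (tourFrom T.rot (nextPerm T.rot c)) + (n + m) ≡ statistic (tourFrom T.rot c)
      [MOD 4] := by
  set φ := nextPerm T.rot with hφ
  let f : ℕ → Vert n m := fun t => ((φ ^ t) c).1
  have hf2 (t : ℕ) : ((φ ^ (t + 1)) c).2 = f t := by
    rw [pow_succ', Equiv.Perm.mul_apply, hφ, nextPerm_apply]
  have hpos : 0 < T.corners.card := Finset.card_pos.2 ⟨c, hc⟩
  rw [card_corners] at hpos
  have hadj (t : ℕ) : T.graph.Adj (f (t + 1)) (f t) := by
    have := mem_corners.1 (pow_nextPerm_mem_corners hc (t + 1))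
    rwa [hf2] at this
  have hper : (φ ^ (2 * (n + m - 1))) c = c := (pow_nextPerm_eq_iff hc _).2 dvd_rfl
  obtain ⟨S, hS1, hS0, hS⟩ := exists_cut (hadj 0)
  have h1' : (φ ^ 1) c = (f 1, f 0) := Prod.ext rfl (hf2 0)
  -- the return to the root along the root edge
  obtain ⟨j, hj, hjE⟩ : ∃ j, (φ ^ (j + 2)) c = (f 0, f 1) ∧ j + 2 ≤ 2 * (n + m - 1) := by
    obtain ⟨k, hk, hk'⟩ := exists_pow_nextPerm_eq hc
      (mem_corners.2 (hadj 0).symm : (f 0, f 1) ∈ T.corners)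
    rcases k with _ | _ | k
    · refine ⟨2 * (n + m - 1) - 2, ?_, by omega⟩
      rw [Nat.sub_add_cancel (by omega), hper]
      exact hk'
    · rw [zero_add, h1'] at hk'
      exact absurd (congrArg Prod.fst hk') (hadj 0).ne
    · exact ⟨k, hk', by omega⟩
  have hinj {s t : ℕ} (hst : s < t) (ht : t < s + 2 * (n + m - 1)) : (φ ^ t) c ≠ (φ ^ s) c := by
    intro h
    rw [hφ, isCycleOn_corners.pow_apply_eq_pow_apply hc, card_corners] at h
    have := (Nat.modEq_iff_dvd' hst.le).1 h.symm
    have := Nat.le_of_dvd (by omega) this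
    omega
  -- The side of the cut changes only when the root edge is traversed, at the steps `t = 0` and `t =
  -- j + 1`; injectivity within a period excludes all other times.
  have hstep (t : ℕ) (h1 : 1 ≤ t) (h2 : t < 2 * (n + m - 1)) (h3 : t ≠ j + 1) :
      S (f (t + 1)) ↔ S (f t) := by
    have e : (φ ^ (t + 1)) c = (f (t + 1), f t) := Prod.ext rfl (hf2 t)
    refine hS _ _ (hadj t) ?_ ?_
    · rw [← e, zero_add, ← h1']
      exact hinj (by omega) (by omega)
    · rw [← e, zero_add, ← hj]
      rcases lt_or_gt_of_ne h3 with h | h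
      · exact (hinj (by omega) (by omega)).symm
      · exact hinj (by omega) (by omega)
  have hin (t : ℕ) (ht : t ≤ j) : S (f (t + 1)) := by
    induction t with
    | zero => exact hS1
    | succ t ih => exact (hstep _ (by omega) (by omega) (by omega)).2 (ih (by omega))
  have hj0 : f (j + 2) = f 0 := by
    change ((φ ^ (j + 2)) c).1 = _
    rw [hj]
  have hj1 : f (j + 1) = f 1 := by rw [← hf2, hj]
  have hout (t : ℕ) (ht : j + 2 + t ≤ 2 * (n + m - 1)) : ¬ S (f (j + 2 + t)) := by
    induction t with
    | zero => rw [add_zero, hj0]; exact hS0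
    | succ t ih =>
      rw [← add_assoc, hstep _ (by omega) (by omega) (by omega)]
      exact ih (by omega)
  obtain ⟨l, hl⟩ : ∃ l, 2 * (n + m) - 1 = j + 3 + l := ⟨2 * (n + m) - 1 - (j + 3), by omega⟩
  -- This time is one step past a full period, so the rerooted tour ends at its own root.
  have hlast : f (l + (j + 3)) = f (j + 1) := by
    have : l + (j + 3) = 1 + 2 * (n + m - 1) := by omega
    simp only [hj1, f]
    rw [this, pow_add, Equiv.Perm.mul_apply, hper]
  have hw : tourFrom T.rot c = f (j + 2) :: ((List.range j).map (fun t => f (t + 1)) ++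
      f (j + 1) :: f (j + 2) :: (List.range l).map fun t => f (t + (j + 3))) := by
    rw [tourFrom, hl]
    convert map_range_split f j l using 2
  have hw' : tourFrom T.rot (φ c) = (List.range j).map (fun t => f (t + 1)) ++
      f (j + 1) :: f (j + 2) :: (List.range l).map (fun t => f (t + (j + 3))) ++ [f (j + 1)] := by
    have := map_range_succ_split f j l
    rw [hlast] at this
    rw [← this, tourFrom, hl]
    simp [f, pow_succ, hφ]
  have hcard : ((List.range j).map (fun t => f (t + 1)) ++
      f (j + 1) :: f (j + 2) :: (List.range l).map fun t => f (t + (j + 3))).toFinset.card =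
      n + m := by
    have := map_range_split f j l
    rw [add_right_comm, List.range_succ_eq_map, List.map_cons] at this
    rw [← (List.cons.inj this).2, toFinset_eq_univ hc, Finset.card_univ]
    · simp
    · intro k hk
      simp only [List.map_map, List.mem_map, List.mem_range, Function.comp_def]
      exact ⟨k, by omega, rfl⟩
  have := reroot_word wrongOrder_swap (r := f (j + 2)) (u := f (j + 1))
    (v := (List.range j).map (fun t => f (t + 1)))
    (w := (List.range l).map fun t => f (t + (j + 3))) (by
      have a1 : ∀ x ∈ (List.range j).map (fun t => f (t + 1)) ++ [f (j + 1)], S x := by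
        intro x hx
        simp only [List.mem_append, List.mem_map, List.mem_range, List.mem_singleton] at hx
        obtain ⟨t, ht, rfl⟩ | rfl := hx
        · exact hin t ht.le
        · exact hin j le_rfl
      intro x hx hx'
      refine absurd (a1 x hx) ?_
      simp only [List.mem_cons, List.mem_map, List.mem_range] at hx'
      obtain rfl | ⟨t, ht, rfl⟩ := hx'
      · exact hout 0 hjE
      · have := hout (t + 1) (by omega)
        rwa [show j + 2 + (t + 1) = t + (j + 3) by omega] at this)
  rw [hcard] at this
  rw [hw, hw', statistic, statistic]
  exact this

theorem sameColour_nextPerm {c : Vert n m × Vert n m} (hc : c ∈ T.corners) :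
    SameColour (nextPerm T.rot c).1 c.1 ↔ False := by
  have h := T.bipartite _ _ (mem_corners.1 (nextPerm_mem_corners.2 hc))
  exact iff_false_intro h

/-- The statistic of a tree with an even number of vertices depends only on the colour of the
root. -/
theorem statistic_modEq (hnm : Even (n + m)) {c d : Vert n m × Vert n m} (hc : c ∈ T.corners)
    (hd : d ∈ T.corners) :
    statistic (tourFrom T.rot d) + (if SameColour d.1 c.1 then 0 else n + m) ≡
      statistic (tourFrom T.rot c) [MOD 4] := by
  obtain ⟨k, -, rfl⟩ := exists_pow_nextPerm_eq hc hd
  clear hd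
  obtain ⟨N, hN⟩ := hnm
  induction k with
  | zero => simp [Nat.ModEq]
  | succ k ih =>
    have h := pow_nextPerm_mem_corners hc k
    have h1 := statistic_nextPerm h
    have h2 := (sameColour_nextPerm h).1
    rw [pow_succ', Equiv.Perm.mul_apply]
    rw [Nat.ModEq] at ih h1 ⊢
    unfold SameColour at *
    generalize (nextPerm T.rot (((nextPerm T.rot) ^ k) c)).1.isLeft = b at *
    generalize (((nextPerm T.rot) ^ k) c).1.isLeft = b' at *
    generalize c.1.isLeft = b'' at *
    have h3 : b = !b' := by revert h2; cases b <;> cases b' <;> simp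
    subst h3
    -- Returning to the initial colour costs `2 * (n + m)`, which is divisible by 4 because `n + m`
    -- is even.
    cases b' <;> cases b'' <;> simp at ih ⊢ <;> omega

end PlaneTree

end Statistic


/-! ### Attaching a leaf inserts a detour into the tour. -/

section Movements

variable {n m : ℕ}

/-- The corners at which a leaf `A` can be attached to a tree with rotation system `δ` that does
not contain `A`: those disjoint from `A`. -/
def Avoids (A : Vert n m) (c : Vert n m × Vert n m) : Prop := c.1 ≠ A ∧ c.2 ≠ A

variable {δ : Vert n m → Equiv.Perm (Vert n m)} {A : Vert n m} {c : Vert n m × Vert n m}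

theorem Avoids.pow_nextPerm (hδ : ∀ x, δ x A = A) (hc : Avoids A c) (k : ℕ) :
    Avoids A ((nextPerm δ ^ k) c) := by
  induction k with
  | zero => exact hc
  | succ k ih =>
    rw [pow_succ', Equiv.Perm.mul_apply]
    exact ⟨fun h => ih.2 ((δ _).injective (h.trans (hδ _).symm)), ih.1⟩

theorem nextPerm_attach_self (hδ : ∀ x, δ x A = A) :
    nextPerm (attach δ A c) c = (A, c.1) ∧ nextPerm (attach δ A c) (c.1, A) = nextPerm δ c := by
  simp [nextPerm_apply, attach, hδ]

theorem nextPerm_attach_leaf (hA : δ A = 1) (hc : Avoids A c) :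
    nextPerm (attach δ A c) (A, c.1) = (c.1, A) := by
  simp [nextPerm_apply, attach, Function.update_of_ne hc.1.symm, hA]

theorem nextPerm_attach_of_ne (hδ : ∀ x, δ x A = A) {e : Vert n m × Vert n m} (he : Avoids A e)
    (hec : e ≠ c) : nextPerm (attach δ A c) e = nextPerm δ e := by
  obtain ⟨x, y⟩ := e
  rw [nextPerm_apply, nextPerm_apply]
  by_cases hx : x = c.1
  · have hy : y ≠ c.2 := fun hy => hec (Prod.ext hx hy)
    subst hx
    have h1 : δ c.1 y ≠ A := fun h => he.2 ((δ _).injective (h.trans (hδ _).symm))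
    simp [attach, Equiv.swap_apply_of_ne_of_ne h1 ((δ c.1).injective.ne hy)]
  · simp [attach, Function.update_of_ne hx]

theorem map_range_add_five {α : Type*} (f : ℕ → α) (k : ℕ) :
    (List.range (k + 5)).map f =
      f 0 :: f 1 :: f 2 :: f 3 :: f 4 :: (List.range k).map fun t => f (t + 5) := by
  rw [add_comm, List.range_add]
  simp [List.range_succ, add_comm]

namespace PlaneTree

variable {T T' : PlaneTree n m}

theorem pow_nextPerm_of_attach (hδ : ∀ x, δ x A = A) (hA : δ A = 1) (hc : Avoids A c)
    (hT : T.rot = attach δ A c) :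
    (nextPerm T.rot ^ 1) c = (A, c.1) ∧ (nextPerm T.rot ^ 2) c = (c.1, A) ∧
      (nextPerm T.rot ^ 3) c = nextPerm δ c := by
  have h1 := nextPerm_attach_self hδ (c := c)
  have h2 := nextPerm_attach_leaf hA hc
  simp [pow_succ, hT, h1, h2]

/-- The detour to `A` takes two steps and is made only at `c`; until the tour returns to `c`, it
follows the tour of the tree without `A` with a delay of two. -/
theorem pow_nextPerm_attach (hδ : ∀ x, δ x A = A) (hA : δ A = 1) (hc : Avoids A c)
    (hT : T.rot = attach δ A c) (hcT : c ∈ T.corners) {k : ℕ} (hk : 1 ≤ k)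
    (hk' : k + 2 ≤ 2 * (n + m - 1)) :
    (nextPerm T.rot ^ (k + 2)) c = (nextPerm δ ^ k) c := by
  induction k, hk using Nat.le_induction with
  | base => exact (pow_nextPerm_of_attach hδ hA hc hT).2.2
  | succ k hk ih =>
    have ih' := ih (by omega)
    rw [add_right_comm, pow_succ', pow_succ' _ k, Equiv.Perm.mul_apply, Equiv.Perm.mul_apply, ih',
      hT]
    refine nextPerm_attach_of_ne hδ (hc.pow_nextPerm hδ k) fun h => ?_
    rw [h, pow_nextPerm_eq_iff hcT] at ih'
    have := Nat.le_of_dvd (by omega) ih'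
    omega

/-- The effect on the statistic of moving a leaf through two corners, counterclockwise. -/
theorem statistic_attach (hnm : Even (n + m)) (hδ : ∀ x, δ x A = A) (hA : δ A = 1)
    (hc : Avoids A c) (hT : T.rot = attach δ A c) (hcT : c ∈ T.corners)
    (hT' : T'.rot = attach δ A ((nextPerm δ ^ 2) c)) (hcT' : (nextPerm δ ^ 2) c ∈ T'.corners) :
    statistic (tourFrom T.rot c) + 2 ≡ statistic (tourFrom T'.rot c) [MOD 4] := by
  set ψ := nextPerm δ with hψ
  set φ := nextPerm T.rot with hφ
  set φ' := nextPerm T'.rot with hφ'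
  have hcard : 3 ≤ n + m := by
    have h3 : ({A, c.1, c.2} : Finset (Vert n m)).card = 3 :=
      Finset.card_eq_three.2 ⟨_, _, _, hc.1.symm, hc.2.symm, (mem_corners.1 hcT).ne, rfl⟩
    have := Finset.card_le_univ ({A, c.1, c.2} : Finset (Vert n m))
    rw [h3] at this
    simpa using this
  -- Evenness excludes three vertices. The period is now `2 * l + 6` with the leaf and `2 * l + 4`
  -- without it.
  obtain ⟨l, hl⟩ : ∃ l, n + m = l + 4 := ⟨n + m - 4, by obtain ⟨N, hN⟩ := hnm; omega⟩
  have hE : 2 * (n + m - 1) = 2 * l + 6 := by omega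
  have h2 := pow_nextPerm_of_attach hδ hA hc hT
  have h3 (k : ℕ) (h : k ≤ 2 * l + 3) : (φ ^ (k + 3)) c = (ψ ^ (k + 1)) c :=
    pow_nextPerm_attach hδ hA hc hT hcT (k := k + 1) (by omega) (by omega)
  have hav := hc.pow_nextPerm hδ (k := 2)
  have h2' := pow_nextPerm_of_attach hδ hA hav hT'
  have h3' (k : ℕ) (h : k ≤ 2 * l + 3) : (φ' ^ (k + 3)) ((ψ ^ 2) c) = (ψ ^ (k + 3)) c := by
    rw [hφ', pow_nextPerm_attach hδ hA hav hT' hcT' (k := k + 1) (by omega) (by omega),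
      ← Equiv.Perm.mul_apply, ← pow_add]
  have hper : (ψ ^ (2 * l + 4)) c = c := by
    rw [← h3 (2 * l + 3) (by omega), hφ, pow_nextPerm_eq_iff hcT, hE]
  have hc4 : c = (φ' ^ (2 * l + 4)) ((ψ ^ 2) c) := by
    rw [h3' (2 * l + 1) (by omega), hper]
  have hper' : (φ' ^ (2 * l + 6)) ((ψ ^ 2) c) = (ψ ^ 2) c := by
    rw [hφ', pow_nextPerm_eq_iff hcT', hE]
  have hshift (k : ℕ) : (φ' ^ (k + 2)) c = (φ' ^ k) ((ψ ^ 2) c) := by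
    nth_rewrite 1 [hc4]
    rw [← Equiv.Perm.mul_apply, ← pow_add, show k + 2 + (2 * l + 4) = k + (2 * l + 6) by omega,
      pow_add, Equiv.Perm.mul_apply, hper']
  have hone : (φ' ^ 1) c = (ψ ^ 1) c := by
    nth_rewrite 1 [hc4]
    rw [← Equiv.Perm.mul_apply, ← pow_add, show 1 + (2 * l + 4) = 2 * l + 2 + 3 by omega,
      h3' _ (by omega), show 2 * l + 2 + 3 = 1 + (2 * l + 4) by omega, pow_add,
      Equiv.Perm.mul_apply, hper]
  let y : ℕ → Vert n m := fun t => ((ψ ^ t) c).1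
  have hy (t : ℕ) : (ψ ^ (t + 1)) c = (y (t + 1), y t) :=
    Prod.ext rfl (by rw [pow_succ', Equiv.Perm.mul_apply, hψ, nextPerm_apply])
  have hy0 : y 0 = c.1 := rfl
  have hyA (t : ℕ) : y t ≠ A := (hc.pow_nextPerm hδ t).1
  have hlen : 2 * (n + m) - 1 = 2 * l + 2 + 5 := by omega
  have hw : tourFrom T.rot c = y 0 :: A :: y 0 :: y 1 :: y 2 ::
      (List.range (2 * l + 2)).map fun t => y (t + 3) := by
    rw [tourFrom, hlen, map_range_add_five, h2.1, h2.2.1, h3 0 (by omega), h3 1 (by omega)]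
    refine congrArg (fun w => _ :: _ :: _ :: _ :: _ :: w) (List.map_congr_left fun t ht => ?_)
    rw [List.mem_range] at ht
    rw [← hφ, h3 (t + 2) (by omega)]
  have hw' : tourFrom T'.rot c = y 0 :: y 1 :: y 2 :: A :: y 2 ::
      (List.range (2 * l + 2)).map fun t => y (t + 3) := by
    rw [tourFrom, hlen, map_range_add_five, ← hφ', hone, hshift 0, hshift 1, hshift 2, h2'.1,
      h2'.2.1]
    refine congrArg (fun w => _ :: _ :: _ :: _ :: _ :: w) (List.map_congr_left fun t ht => ?_)
    rw [List.mem_range] at ht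
    rw [hshift, h3' _ (by omega)]
  have hcor (k : ℕ) (h : k ≤ 2 * l + 3) : T.graph.Adj (y (k + 1)) (y k) := by
    have := mem_corners.1 (pow_nextPerm_mem_corners hcT (k + 3))
    rwa [← hφ, h3 k h, hy] at this
  rw [hw, hw']
  refine move_word wrongOrder_swap ?_ (hyA 0).symm (hyA 1).symm (hyA 2).symm
    (hcor 0 (by omega)).symm.ne (hcor 1 (by omega)).symm.ne ?_ ⟨fun h => ?_, fun h => ?_⟩
  · simp only [List.mem_map, not_exists, not_and]
    exact fun t _ => hyA _
  · exact List.mem_map.2 ⟨2 * l + 1, by simp, congrArg Prod.fst hper⟩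
  -- If `y 2 = y 0`, the rotation at `y 1` fixes `y 0`, so `y 1` has no other neighbour. A later
  -- visit would then repeat the corner `(y 1, y 0)` within one period.
  · simp only [List.mem_map, List.mem_range, not_exists, not_and]
    intro t ht hty
    have hfix : T.rot (y 1) (y 0) = y 0 := by
      have : φ ((ψ ^ (0 + 1)) c) = (ψ ^ (1 + 1)) c := by
        rw [← h3 0 (by omega), ← h3 1 (by omega), ← Equiv.Perm.mul_apply, ← pow_succ']
      rw [hy, hy] at this
      exact (congrArg Prod.fst this).trans h
    have huniq : y (t + 2) = y 0 := by
      by_contra hne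
      have hadj := hcor (t + 2) (by omega)
      rw [hty] at hadj
      exact (T.rot_cycle (y 1)).apply_ne ⟨_, hadj, _, hcor 0 (by omega), hne⟩
        (hcor 0 (by omega)) hfix
    have heq : (φ ^ (t + 5)) c = (φ ^ 3) c := by
      rw [h3 0 (by omega), h3 (t + 2) (by omega), hy, hy, hty, huniq]
    rw [hφ, isCycleOn_corners.pow_apply_eq_pow_apply hcT, card_corners] at heq
    have := (Nat.modEq_iff_dvd' (by omega)).1 heq.symm
    have := Nat.le_of_dvd (by omega) this
    omega
  -- Otherwise the corner `(y 1, y 2)` has to be met somewhere; it is none of the first five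
  -- corners, so `y 1` occurs in the rest of the word.
  · by_contra hne
    obtain ⟨k, hk, hk'⟩ := exists_pow_nextPerm_eq hcT
      (mem_corners.2 (hcor 1 (by omega)).symm : (y 1, y 2) ∈ T.corners)
    rw [← hφ] at hk'
    rcases k with _ | _ | _ | _ | _ | k
    · exact (hcor 0 (by omega)).ne (congrArg Prod.fst hk').symm
    · rw [h2.1] at hk'
      exact hyA 1 (congrArg Prod.fst hk').symm
    · rw [h2.2.1] at hk'
      exact hyA 2 (congrArg Prod.snd hk').symm
    · rw [h3 0 (by omega), hy] at hk'
      exact hne (congrArg Prod.snd hk').symm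
    · rw [h3 1 (by omega), hy] at hk'
      exact (hcor 1 (by omega)).ne (Prod.ext_iff.1 hk').1
    · rw [h3 (k + 2) (by omega), hy] at hk'
      exact h (List.mem_map.2 ⟨k, by simp; omega, (Prod.ext_iff.1 hk').1⟩)

end PlaneTree

end Movements


/-! ### Detaching a leaf, and elementary movements as movements through two corners. -/

namespace PlaneTree

variable {n m : ℕ} {T T' : PlaneTree n m} {A B : Vert n m}

theorem symm_rot_mem_corners {x y : Vert n m} (h : T.graph.Adj x y) :
    (x, (T.rot x).symm y) ∈ T.corners := by
  rw [mem_corners, ← adj_rot_iff]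
  simpa using h

theorem detach_apply_leaf (ρ : Vert n m → Equiv.Perm (Vert n m)) (A x : Vert n m) :
    detach ρ A x A = A := by
  simp [detach]

theorem rot_leaf (leaf : ∀ x, T.graph.Adj A x → x = B) (h : T.graph.Adj A B) : T.rot A = 1 := by
  refine Equiv.ext fun y => ?_
  by_cases hy : T.graph.Adj A y
  · rw [leaf y hy, leaf _ (adj_rot_iff.2 h)]
    rfl
  · exact T.rot_fix A y hy

theorem detach_leaf (leaf : ∀ x, T.graph.Adj A x → x = B) (h : T.graph.Adj A B) :
    detach T.rot A A = 1 := by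
  rw [detach, rot_leaf leaf h, mul_one, Equiv.Perm.one_apply, Equiv.swap_self]
  rfl

/-- Attaching a leaf at the place where it was detached. -/
theorem attach_detach (leaf : ∀ x, T.graph.Adj A x → x = B) :
    T.rot = attach (detach T.rot A) A (B, (T.rot B).symm A) := by
  funext x
  by_cases hx : x = B
  · subst hx
    ext y
    simp [attach, detach]
  · have : T.rot x A = A := T.rot_fix x A fun h => hx (leaf x h.symm)
    rw [attach, Function.update_of_ne hx, detach, this, Equiv.swap_self]
    rfl

/-- The corners of a plane tree disjoint from a leaf `A` are preserved when one goes around the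
tree without `A`. -/
theorem nextCorner_detach {c : Vert n m × Vert n m} (hc : Avoids A c) (hcT : c ∈ T.corners)
    (s : Sense) : Avoids A (nextCorner s (detach T.rot A) c) ∧
      nextCorner s (detach T.rot A) c ∈ T.corners ∧
      T.graph.Adj (nextCorner s (detach T.rot A) c).1 c.1 := by
  have key (x y : Vert n m) (hy : y ≠ A) :
      T.graph.Adj x (detach T.rot A x y) ↔ T.graph.Adj x y := by
    rw [← adj_rot_iff (y := y)]
    by_cases h : T.rot x y = A
    · rw [h, ← adj_rot_iff (y := A)]
      simp [detach, h]
    · simp [detach, Equiv.swap_apply_of_ne_of_ne h ((T.rot x).injective.ne hy)]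
  obtain ⟨x, y⟩ := c
  have hxy := mem_corners.1 hcT
  cases s with
  | ccw =>
    have h := ((key x y hc.2).2 hxy).symm
    refine ⟨⟨fun h => hc.2 ((detach T.rot A x).injective (h.trans ?_)), hc.1⟩,
      mem_corners.2 h, h⟩
    exact (detach_apply_leaf _ _ _).symm
  | cw =>
    have h : (detach T.rot A y).symm x ≠ A := by
      rw [Ne, Equiv.symm_apply_eq, detach_apply_leaf]
      exact hc.1
    refine ⟨⟨hc.2, h⟩, mem_corners.2 ?_, hxy.symm⟩
    rw [nextCorner, ← key _ _ h]
    simpa using hxy.symm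

theorem cornerAt_detach {c : Vert n m × Vert n m} (hc : Avoids A c) (hcT : c ∈ T.corners)
    (s : Sense) (t : ℕ) : Avoids A (cornerAt s (detach T.rot A) c t) ∧
      cornerAt s (detach T.rot A) c t ∈ T.corners := by
  induction t with
  | zero => exact ⟨hc, hcT⟩
  | succ t ih =>
    rw [cornerAt, Function.iterate_succ_apply']
    have := nextCorner_detach ih.1 ih.2 s
    exact ⟨this.1, this.2.1⟩

theorem isLeft_cornerAt_detach {c : Vert n m × Vert n m} (hc : Avoids A c) (hcT : c ∈ T.corners)
    (s : Sense) (t : ℕ) : (cornerAt s (detach T.rot A) c (t + 1)).1.isLeft =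
      !(cornerAt s (detach T.rot A) c t).1.isLeft := by
  have ht := cornerAt_detach hc hcT s t
  have := T.bipartite _ _ (nextCorner_detach ht.1 ht.2 s).2.2
  rw [cornerAt, Function.iterate_succ_apply']
  exact Bool.eq_not_iff.2 this

end PlaneTree

variable {n m : ℕ} {T T' : PlaneTree n m}

/-- A second neighbour of `B` keeps the rotation at `B` from fixing `A`, so the place of attachment
is a genuine corner of the remaining tree. -/
theorem IsMovement.avoids {A B : Vert n m} {s : Sense} {L : ℕ} (h : IsMovement T T' A B s L) :
    Avoids A (B, (T.rot B).symm A) := by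
  refine ⟨h.adj.symm.ne, fun hA => ?_⟩
  obtain ⟨D, hD, hBD⟩ := h.rest
  refine (T.rot_cycle B).apply_ne ⟨A, h.adj.symm, D, hBD, hD.symm⟩ h.adj.symm ?_
  exact ((Equiv.symm_apply_eq _).1 hA).symm

/-- In an elementary movement the leaf is moved through two corners. -/
theorem IsMovement.eq_two {A B : Vert n m} {s : Sense} {L : ℕ} (h : IsMovement T T' A B s L)
    (hL : T.bypassed A B s L = 1) : L = 2 := by
  -- The vertices at odd times are those of the leaf's colour: one bypassed vertex forces `L` to be
  -- 2 or 3, and the colour of the target excludes 3.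
  have hcol (t : ℕ) : (T.leafCorner A B s (t + 1)).1.isLeft = !(T.leafCorner A B s t).1.isLeft :=
    PlaneTree.isLeft_cornerAt_detach h.avoids (PlaneTree.symm_rot_mem_corners h.adj.symm) s t
  have h0 : (T.leafCorner A B s 0).1.isLeft = !A.isLeft :=
    Bool.eq_not_iff.2 (T.bipartite _ _ h.adj.symm)
  have hC := h.colour
  rw [PlaneTree.bypassed] at hL
  unfold SameColour at hL hC
  match L, hL, hC with
  | 0, hL, _ => simp at hL
  | 1, hL, _ => exact absurd hL (by
      rw [Finset.range_one, Finset.filter_singleton, h0, if_neg (Bool.not_ne_self _)]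
      simp)
  | 2, _, _ => rfl
  | 3, _, hC => simp [hcol, h0] at hC
  | L + 4, hL, _ =>
    have : ({1, 3} : Finset ℕ) ⊆ (Finset.range (L + 4)).filter
        fun t => (T.leafCorner A B s t).1.isLeft = A.isLeft := by
      intro t ht
      rw [Finset.mem_insert, Finset.mem_singleton] at ht
      obtain rfl | rfl := ht <;> simp [hcol, h0]
    have := Finset.card_le_card this
    rw [hL] at this
    simp at this

/-- An elementary movement changes the statistic by two modulo four. -/
theorem IsElementaryMovement.exists_statistic (hnm : Even (n + m))
    (h : IsElementaryMovement T T') : ∃ c ∈ T.corners, c ∈ T'.corners ∧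
      statistic (tourFrom T.rot c) + 2 ≡ statistic (tourFrom T'.rot c) [MOD 4] := by
  obtain ⟨A, B, s, L, h, hL⟩ := h
  obtain rfl := h.eq_two hL
  set δ := detach T.rot A with hδ
  set c : Vert n m × Vert n m := (B, (T.rot B).symm A) with hc
  have hcT : c ∈ T.corners := PlaneTree.symm_rot_mem_corners h.adj.symm
  have hcA : Avoids A c := h.avoids
  obtain ⟨hdA, hdT⟩ := PlaneTree.cornerAt_detach hcA hcT s 2
  have hδA : ∀ x, δ x A = A := PlaneTree.detach_apply_leaf _ _
  have hδ1 : δ A = 1 := PlaneTree.detach_leaf h.leaf h.adj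
  have hT : T.rot = attach δ A c := PlaneTree.attach_detach h.leaf
  have hT' : T'.rot = attach δ A (cornerAt s δ c 2) := h.rot_eq
  have hmem (e : Vert n m × Vert n m) (he : Avoids A e) (heT : e ∈ T.corners) :
      e ∈ T'.corners := by
    rw [PlaneTree.mem_corners, h.graph_eq, SimpleGraph.sup_adj,
      SimpleGraph.deleteIncidenceSet_adj]
    exact Or.inl ⟨PlaneTree.mem_corners.1 heT, he⟩
  have hcT' := hmem c hcA hcT
  have hdT' := hmem _ hdA hdT
  cases s with
  | ccw =>
    rw [cornerAt_ccw] at hT' hdT'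
    exact ⟨c, hcT, hcT', PlaneTree.statistic_attach hnm hδA hδ1 hcA hT hcT hT' hdT'⟩
  | cw =>
    -- A clockwise movement is the reverse of a counterclockwise one from `T'` to `T`, and a change
    -- by 2 modulo 4 is symmetric.
    set d := cornerAt .cw δ c 2 with hd
    have hcd : c = (nextPerm δ ^ 2) d := by
      change c = nextPerm δ (nextPerm δ ((nextPerm δ).symm ((nextPerm δ).symm c)))
      simp
    rw [hcd] at hT hcT
    refine ⟨d, hdT, hdT', ?_⟩
    have := PlaneTree.statistic_attach hnm hδA hδ1 hdA hT' hdT' hT hcT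
    rw [Nat.ModEq] at this ⊢
    omega

theorem PlaneTree.invariant_eq (T : PlaneTree n m) (i : Fin n) (j : Fin m) :
    ∃ a b, statistic (tourFrom T.rot (.inl i, (T.rot (.inl i)).symm (.inr j))) = 2 * a + b ∧
      T.invariant i j = (a + (b + ((n : ℤ) - (m : ℤ)).natAbs / 2) / 2) % 2 :=
  ⟨_, _, rfl, by
    rw [PlaneTree.invariant, PlaneTree.string, stringInvariant_writeString, tour_eq_tourFrom]⟩

end PlaneTrees

theorem theorem4p1 (n m : ℕ) (hnm : Even (n + m)) (T T' : PlaneTrees.PlaneTree n m)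
    (hT : PlaneTrees.IsElementaryMovement T T')
    (i : Fin n) (j : Fin m) (hij : T.graph.Adj (Sum.inl i) (Sum.inr j))
    (i' : Fin n) (j' : Fin m) (hij' : T'.graph.Adj (Sum.inl i') (Sum.inr j')) :
    (T.invariant i j = 0 ∧ T'.invariant i' j' = 1) ∨
      (T.invariant i j = 1 ∧ T'.invariant i' j' = 0) := by
  obtain ⟨c, hc, hc', h⟩ := hT.exists_statistic hnm
  -- The corner `c` belongs to both trees, and all chosen roots are white, so the correction from
  -- `c` to the chosen root is the same for `T` and `T'` and cancels.
  have root (S : PlaneTrees.PlaneTree n m) (hc : c ∈ S.corners) (k : Fin n) (l : Fin m)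
      (hkl : S.graph.Adj (Sum.inl k) (Sum.inr l)) :
      PlaneTrees.statistic (PlaneTrees.tourFrom S.rot (.inl k, (S.rot (.inl k)).symm (.inr l))) +
        (if true = c.1.isLeft then 0 else n + m) ≡
      PlaneTrees.statistic (PlaneTrees.tourFrom S.rot c) [MOD 4] :=
    PlaneTrees.PlaneTree.statistic_modEq hnm hc (PlaneTrees.PlaneTree.symm_rot_mem_corners hkl)
  have h1 := root T hc i j hij
  have h2 := root T' hc' i' j' hij'
  obtain ⟨a, b, hab, hI⟩ := T.invariant_eq i j
  obtain ⟨a', b', hab', hI'⟩ := T'.invariant_eq i' j'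
  rw [hab] at h1
  rw [hab'] at h2
  rw [hI, hI']
  clear hI hI' hab hab' root
  rw [Nat.ModEq] at h h1 h2
  generalize ((n : ℤ) - (m : ℤ)).natAbs / 2 = e
  generalize (if true = c.1.isLeft then 0 else n + m) = z at h1 h2
  -- Equal parities make the two halvings round alike, so the difference 2 modulo 4 becomes a
  -- difference 1 modulo 2.
  have hpar : (b + e) % 2 = (b' + e) % 2 := by omega
  have hdiv : (2 * a + (b + e) + 2) % 4 = (2 * a' + (b' + e)) % 4 := by omega
  generalize b + e = q at *
  generalize b' + e = q' at *
  omega
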